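/- Let $M>0$. There are constants $C_s=C_s(s,M)>0$, $s\ge 2$, such that the following holds for every fixed integer $r\ge 2$ and all parameters $\boldsymbol B=\boldsymbol B^{(n)}=(\boldsymbol\beta_2,\dots,\boldsymbol\beta_r)$, $n\ge 1$, with $\boldsymbol\beta_s=(\beta_{s,v})_{v\in[n]}\in\mathbb R^n$ and $\|\boldsymbol\beta_s\|_\infty\le M$ for $2\le s\le r$ (the parameters may depend on $n$). Let $H_n$ be a sample from the $r$-layered hypergraph $\boldsymbol\beta$-model: the random hypergraph on the vertex set $[n]=\{1,\dots,n\}$ in which, for every $2\le s\le r$, each $s$-element set $\{v_1,\dots,v_s\}\subseteq[n]$ is a hyperedge independently with probability $$\frac{e^{\beta_{s,v_1}+\cdots+\beta_{s,v_s}}}{1+e^{\beta_{s,v_1}+\cdots+\beta_{s,v_s}}},$$ and let $d_s(v)$ be the number of hyperedges of $H_n$ of size $s$ that contain $v$. Then, with probability tending to $1$ as $n\to\infty$, the likelihood equations $$d_s(v)=\sum_{\substack{\{v_2,\dots,v_s\}\subseteq[n]\setminus\{v\}\\ v_2,\dots,v_s\text{ distinct}}}\frac{e^{\hat\beta_{s,v}+\hat\beta_{s,v_2}+\cdots+\hat\beta_{s,v_s}}}{1+e^{\hat\beta_{s,v}+\hat\beta_{s,v_2}+\cdots+\hat\beta_{s,v_s}}}\qquad(v\in[n],\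 2\le s\le r)$$ (the sum being over all $(s-1)$-element subsets of $[n]\setminus\{v\}$) have a unique solution $\hat{\boldsymbol B}=(\hat{\boldsymbol\beta}_2,\dots,\hat{\boldsymbol\beta}_r)\in(\mathbb R^n)^{r-1}$, and this solution satisfies $$\|\hat{\boldsymbol\beta}_s-\boldsymbol\beta_s\|_2\le C_s\sqrt{\frac1{n^{s-2}}}\qquad\text{and}\qquad\|\hat{\boldsymbol\beta}_s-\boldsymbol\beta_s\|_\infty\le C_s\sqrt{\frac{\log n}{n^{s-1}}}\qquad\text{for all }2\le s\le r.$$ -/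

import Mathlib

open MeasureTheory Filter Topology

noncomputable section

/-- The layers `s = 2, …, r`. -/
abbrev Layer (r : ℕ) : Type := {s : ℕ // s ∈ Finset.Icc 2 r}

/-- The possible hyperedges: subsets of the vertex set (modelled by `Fin n`) of size `2, …, r`. -/
abbrev Hyperedge (n r : ℕ) : Type := {e : Finset (Fin n) // e.card ∈ Finset.Icc 2 r}

/-- The layer to which a hyperedge belongs: its size. -/
def Hyperedge.layer {n r : ℕ} (e : Hyperedge n r) : Layer r := ⟨e.1.card, e.2⟩

/-- A hypergraph on the vertex set `Fin n` all of whose hyperedges have size between `2` and `r`,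
given by its set of hyperedges.  (The σ-algebra is Mathlib's one on `Finset`, which is discrete
here.) -/
abbrev LayeredHypergraph (n r : ℕ) : Type := Finset (Hyperedge n r)

/-- Parameters `B = (β_2, …, β_r)` with `β_s ∈ ℝⁿ`.  The norm of `Fin n → ℝ` in Mathlib is the
`L_∞` norm. -/
abbrev LayerParams (n r : ℕ) : Type := Layer r → Fin n → ℝ

/-- For a parameter vector `β ∈ ℝⁿ` and a set `e` of vertices, the probability
`exp (∑_{v ∈ e} β_v) / (1 + exp (∑_{v ∈ e} β_v))`. -/
def edgeProb {n : ℕ} (β : Fin n → ℝ) (e : Finset (Fin n)) : ℝ :=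
  Real.exp (∑ v ∈ e, β v) / (1 + Real.exp (∑ v ∈ e, β v))

theorem edgeProb_mem_unitInterval {n : ℕ} (β : Fin n → ℝ) (e : Finset (Fin n)) :
    edgeProb β e ∈ unitInterval := by
  have h := Real.exp_pos (∑ v ∈ e, β v)
  refine ⟨by unfold edgeProb; positivity, ?_⟩
  unfold edgeProb
  rw [div_le_one (by positivity)]
  linarith

/-- The hypergraph whose hyperedges are those marked `true`. -/
def hypergraphOfIndicator {n r : ℕ} (x : Hyperedge n r → Bool) : LayeredHypergraph n r :=
  Finset.univ.filter fun e => x e = true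

theorem measurable_hypergraphOfIndicator {n r : ℕ} :
    Measurable (hypergraphOfIndicator : (Hyperedge n r → Bool) → LayeredHypergraph n r) :=
  measurable_of_countable _

/-- The `r`-layered hypergraph `β`-model on `n` vertices with parameters `B`: the law of the random
hypergraph in which the hyperedges `e` of size `s`, `2 ≤ s ≤ r`, are present independently with
probability `edgeProb (B s) e`. -/
def layeredBetaModel (n r : ℕ) (B : LayerParams n r) : Measure (LayeredHypergraph n r) :=
  (Measure.pi fun e : Hyperedge n r =>
    ProbabilityTheory.bernoulliMeasure true false
      ⟨edgeProb (B e.layer) e.1, edgeProb_mem_unitInterval (B e.layer) e.1⟩).map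
    hypergraphOfIndicator

instance {n r : ℕ} (B : LayerParams n r) : IsProbabilityMeasure (layeredBetaModel n r B) :=
  Measure.isProbabilityMeasure_map measurable_hypergraphOfIndicator.aemeasurable

/-- The `s`-degree of the vertex `v`: the number of hyperedges of size `s` passing through `v`. -/
def sDegree {n r : ℕ} (H : LayeredHypergraph n r) (s : ℕ) (v : Fin n) : ℕ :=
  (H.filter fun e => e.1.card = s ∧ v ∈ e.1).card

/-- `B` solves the likelihood equations of the observed hypergraph `H`: for every layer `s` and
every vertex `v`, the `s`-degree of `v` equals the sum of the edge probabilities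
`exp (β_{s,v} + ∑_{u ∈ t} β_{s,u}) / (1 + exp (β_{s,v} + ∑_{u ∈ t} β_{s,u}))` over all
`(s-1)`-element sets `t` of vertices different from `v`. -/
def SolvesLikelihoodEquations {n r : ℕ} (H : LayeredHypergraph n r) (B : LayerParams n r) : Prop :=
  ∀ (s : Layer r) (v : Fin n),
    (sDegree H s v : ℝ) =
      ∑ t ∈ (Finset.univ.erase v).powersetCard (s.1 - 1), edgeProb (B s) (insert v t)

/-- The `L_2` norm of a vector. -/
def l2norm {n : ℕ} (x : Fin n → ℝ) : ℝ := Real.sqrt (∑ v, x v ^ 2)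

/-- The good event: the likelihood equations have exactly one solution `Bhat`, and for every layer
`s` this solution satisfies `‖Bhat_s - β_s‖₂ ≤ C s * √(1 / n^(s-2))` and
`‖Bhat_s - β_s‖_∞ ≤ C s * √(log n / n^(s-1))`. -/
def mleRateEvent (n r : ℕ) (C : ℕ → ℝ) (B : LayerParams n r) : Set (LayeredHypergraph n r) :=
  {H | (∃! Bhat : LayerParams n r, SolvesLikelihoodEquations H Bhat) ∧
    ∀ Bhat : LayerParams n r, SolvesLikelihoodEquations H Bhat → ∀ s : Layer r,
      l2norm (Bhat s - B s) ≤ C s * Real.sqrt (1 / (n : ℝ) ^ (s.1 - 2)) ∧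
      ‖Bhat s - B s‖ ≤ C s * Real.sqrt (Real.log n / (n : ℝ) ^ (s.1 - 1))}

end

/-! The layers decouple: in layer `s` the equations say that the observed degree vector `d` equals
`expectedDegree s`, the gradient of a convex function of the parameters.

Deterministic part. Suppose `d` is close to its mean under `β`. Minimise `negLogLikelihood` over the
box `β + [-1,1]^n`; by compactness a minimiser `β + x` exists, and it satisfies one-sided likelihood
equations (`exists_box_critical`). Edge sums are bounded on the box, so the logistic slope is
bounded below there and the gradient is strongly monotone with constant of order `n^(s-1)`; pairing
with `x` and Cauchy–Schwarz give the `L_2` rate (`l2norm_le_of_critical`). In one coordinate, `x v`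
contributes at least order `n^(s-1) * |x v|` and the other coordinates at most `n^(s-2) * ∑ |x u|`,
which the `L_2` bound controls; this is the `L_∞` rate (`abs_le_of_critical`). That rate tends to
`0`, so `x` is interior and `β + x` solves the equations. Strict monotonicity makes the solution
globally unique (`expectedDegree_injective`).

Random part. Hoeffding and a union bound control each degree, but would cost a logarithm in the
`L_2` norm. Instead the sum of squared deviations is expanded as `∑ |e ∩ f| X_e X_f`: the diagonal
is bounded surely, the off-diagonal part by Chebyshev (`integral_sq_offDiagForm_le`). Each layer
fails with probability `O(1/n)`. -/

/-! ### The logistic function -/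

/-- The logistic function `z ↦ exp z / (1 + exp z)`. -/
noncomputable def logistic (z : ℝ) : ℝ := Real.exp z / (1 + Real.exp z)

theorem edgeProb_eq_logistic {n : ℕ} (β : Fin n → ℝ) (e : Finset (Fin n)) :
    edgeProb β e = logistic (∑ v ∈ e, β v) := rfl

theorem logistic_sub (a b : ℝ) :
    logistic b - logistic a =
      (Real.exp b - Real.exp a) / ((1 + Real.exp a) * (1 + Real.exp b)) := by
  have ha := Real.exp_pos a
  have hb := Real.exp_pos b
  unfold logistic
  field_simp
  ring

theorem exp_sub_exp_le (a b : ℝ) : Real.exp b - Real.exp a ≤ Real.exp b * (b - a) := by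
  have h := mul_le_mul_of_nonneg_left (Real.add_one_le_exp (a - b)) (Real.exp_pos b).le
  rw [← Real.exp_add, add_sub_cancel] at h
  linarith

theorem logistic_strictMono : StrictMono logistic := by
  intro a b hab
  have ha := Real.exp_pos a
  have hb := Real.exp_pos b
  have h := logistic_sub a b
  have : 0 < logistic b - logistic a := by
    rw [h]
    exact div_pos (sub_pos.2 (Real.exp_lt_exp.2 hab)) (by positivity)
  linarith

theorem logistic_sub_le {a b : ℝ} (hab : a ≤ b) : logistic b - logistic a ≤ b - a := by
  have ha := Real.exp_pos a
  have hb := Real.exp_pos b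
  rw [logistic_sub, div_le_iff₀ (by positivity)]
  refine (exp_sub_exp_le a b).trans ?_
  rw [mul_comm]
  refine mul_le_mul_of_nonneg_left ?_ (sub_nonneg.2 hab)
  nlinarith [mul_pos ha hb]

theorem abs_logistic_sub_le (a b : ℝ) : |logistic b - logistic a| ≤ |b - a| := by
  rcases le_total a b with h | h
  · rw [abs_of_nonneg (sub_nonneg.2 (logistic_strictMono.monotone h)),
      abs_of_nonneg (sub_nonneg.2 h)]
    exact logistic_sub_le h
  · rw [abs_sub_comm, abs_sub_comm b,
      abs_of_nonneg (sub_nonneg.2 (logistic_strictMono.monotone h)),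
      abs_of_nonneg (sub_nonneg.2 h)]
    exact logistic_sub_le h

/-- A lower bound for the slope of the logistic function on `[-L, L]`. -/
noncomputable def logisticSlope (L : ℝ) : ℝ := Real.exp (-L) / (1 + Real.exp L) ^ 2

theorem logisticSlope_pos (L : ℝ) : 0 < logisticSlope L := by
  unfold logisticSlope
  have := Real.exp_pos L
  positivity

/-- In `logistic_sub`, the numerator is bounded below by the tangent to `exp` at `a`, and the
denominator above by its value at `L`. -/
theorem logisticSlope_mul_le {L a b : ℝ} (ha : -L ≤ a) (hb : b ≤ L) (hab : a ≤ b) :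
    logisticSlope L * (b - a) ≤ logistic b - logistic a := by
  have ha' := Real.exp_pos a
  have hb' := Real.exp_pos b
  have hL := Real.exp_pos L
  rw [logistic_sub, logisticSlope, div_mul_eq_mul_div]
  have h1 : Real.exp (-L) * (b - a) ≤ Real.exp b - Real.exp a := by
    have h2 := exp_sub_exp_le b a
    have h3 := mul_le_mul_of_nonneg_right (Real.exp_le_exp.2 ha) (sub_nonneg.2 hab)
    linarith
  have h4 : (1 + Real.exp a) * (1 + Real.exp b) ≤ (1 + Real.exp L) ^ 2 := by
    rw [sq]
    have := Real.exp_le_exp.2 hb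
    have := Real.exp_le_exp.2 (hab.trans hb)
    gcongr
  exact div_le_div₀ (sub_nonneg.2 (Real.exp_le_exp.2 hab)) h1 (by positivity) h4

theorem logisticSlope_mul_sq_le {L a b : ℝ} (ha : |a| ≤ L) (hb : |b| ≤ L) :
    logisticSlope L * (b - a) ^ 2 ≤ (logistic b - logistic a) * (b - a) := by
  rw [abs_le] at ha hb
  rcases le_total a b with h | h
  · have := mul_le_mul_of_nonneg_right (logisticSlope_mul_le ha.1 hb.2 h) (sub_nonneg.2 h)
    nlinarith
  · have := mul_le_mul_of_nonneg_right (logisticSlope_mul_le hb.1 ha.2 h) (sub_nonneg.2 h)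
    nlinarith

theorem hasDerivAt_softplus (z : ℝ) :
    HasDerivAt (fun z => Real.log (1 + Real.exp z)) (logistic z) z := by
  have h := ((Real.hasDerivAt_exp z).const_add 1).log (by positivity)
  exact h

/-! ### Sums over the edges of the complete uniform hypergraph -/

/-- The `s`-element subsets of `Fin n`. -/
def uniformEdges (n s : ℕ) : Finset (Finset (Fin n)) := Finset.univ.powersetCard s

theorem mem_uniformEdges {n s : ℕ} {e : Finset (Fin n)} : e ∈ uniformEdges n s ↔ e.card = s := by
  simp [uniformEdges]

/-- The expected `s`-degree of `v` under the parameters `β`. -/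
noncomputable def expectedDegree {n : ℕ} (s : ℕ) (β : Fin n → ℝ) (v : Fin n) : ℝ :=
  ∑ e ∈ uniformEdges n s with v ∈ e, edgeProb β e

theorem card_uniformEdges_superset {n s : ℕ} (t : Finset (Fin n)) (ht : t.card ≤ s) :
    ((uniformEdges n s).filter (t ⊆ ·)).card = (n - t.card).choose (s - t.card) := by
  unfold uniformEdges
  rw [Finset.card_filter_powersetCard_subset] <;> simp [ht]

theorem card_uniformEdges_mem {n s : ℕ} (hs : 1 ≤ s) (v : Fin n) :
    ((uniformEdges n s).filter (v ∈ ·)).card = (n - 1).choose (s - 1) := by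
  simpa using card_uniformEdges_superset (s := s) {v} (by simpa using hs)

theorem card_uniformEdges_pair {n s : ℕ} (hs : 2 ≤ s) {u v : Fin n} (huv : u ≠ v) :
    ((uniformEdges n s).filter (fun e => u ∈ e ∧ v ∈ e)).card = (n - 2).choose (s - 2) := by
  have h := card_uniformEdges_superset (s := s) {u, v} (by rw [Finset.card_pair huv]; exact hs)
  rw [Finset.card_pair huv] at h
  rw [← h]
  congr 1
  ext e
  simp [Finset.insert_subset_iff]

theorem sum_powersetCard_erase {n s : ℕ} (hs : 1 ≤ s) (v : Fin n) (f : Finset (Fin n) → ℝ) :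
    ∑ t ∈ (Finset.univ.erase v).powersetCard (s - 1), f (insert v t) =
      ∑ e ∈ uniformEdges n s with v ∈ e, f e := by
  refine Finset.sum_nbij' (insert v) (fun e => e.erase v) ?_ ?_ ?_ ?_ ?_
  · intro t ht
    rw [Finset.mem_powersetCard] at ht
    have hv : v ∉ t := fun h => by simpa using ht.1 h
    simp only [Finset.mem_filter, mem_uniformEdges, Finset.mem_insert_self, and_true]
    rw [Finset.card_insert_of_notMem hv]
    omega
  · intro e he
    simp only [Finset.mem_filter, mem_uniformEdges] at he
    rw [Finset.mem_powersetCard, Finset.card_erase_of_mem he.2, he.1]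
    exact ⟨Finset.erase_subset_erase _ (Finset.subset_univ _), rfl⟩
  · intro t ht
    rw [Finset.mem_powersetCard] at ht
    exact Finset.erase_insert fun h => by simpa using ht.1 h
  · intro e he
    exact Finset.insert_erase (Finset.mem_filter.1 he).2
  · intros
    rfl

/-- Double counting of vertex–edge incidences: summing over the edges at a vertex is adjoint to
summing over the vertices of an edge. -/
theorem sum_mul_sum_filter_mem {n s : ℕ} (x : Fin n → ℝ) (f : Finset (Fin n) → ℝ) :
    ∑ v, x v * ∑ e ∈ uniformEdges n s with v ∈ e, f e =
      ∑ e ∈ uniformEdges n s, f e * ∑ v ∈ e, x v := by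
  simp_rw [Finset.sum_filter, Finset.mul_sum]
  rw [Finset.sum_comm]
  refine Finset.sum_congr rfl fun e _ => ?_
  simp [mul_comm]

/-- By Pascal's rule the matrix of the right-hand form is `(n-2).choose (s-1)` times the identity
plus `(n-2).choose (s-2)` times the all-ones matrix, which is positive semidefinite. -/
theorem sum_sq_edges_ge {n s : ℕ} (hs : 2 ≤ s) (hn : 2 ≤ n) (x : Fin n → ℝ) :
    ((n - 2).choose (s - 1) : ℝ) * ∑ v, x v ^ 2 ≤
      ∑ e ∈ uniformEdges n s, (∑ v ∈ e, x v) ^ 2 := by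
  have hsplit : ((n - 1).choose (s - 1) : ℝ) =
      (n - 2).choose (s - 2) + (n - 2).choose (s - 1) := by
    obtain ⟨m, rfl⟩ := Nat.exists_eq_add_of_le hn
    obtain ⟨k, rfl⟩ := Nat.exists_eq_add_of_le hs
    have h1 : 2 + m - 1 = m + 1 := by omega
    have h2 : 2 + k - 1 = k + 1 := by omega
    rw [h1, h2, Nat.choose_succ_succ]
    push_cast
    simp
  have hrow (u : Fin n) : ∑ e ∈ uniformEdges n s with u ∈ e, ∑ v ∈ e, x v =
      ((n - 2).choose (s - 1) : ℝ) * x u + ((n - 2).choose (s - 2) : ℝ) * ∑ v, x v := by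
    have h1 : ∑ e ∈ uniformEdges n s with u ∈ e, ∑ v ∈ e, x v =
        ∑ v, ((uniformEdges n s).filter (fun e => u ∈ e ∧ v ∈ e)).card * x v := by
      have h2 (e : Finset (Fin n)) : ∑ v ∈ e, x v = ∑ v, if v ∈ e then x v else 0 := by
        simp
      simp_rw [h2]
      rw [Finset.sum_comm]
      refine Finset.sum_congr rfl fun v _ => ?_
      rw [← Finset.sum_filter, Finset.filter_filter, Finset.sum_const, nsmul_eq_mul]
    rw [h1, ← Finset.add_sum_erase _ _ (Finset.mem_univ u),
      ← Finset.add_sum_erase _ x (Finset.mem_univ u), mul_add, Finset.mul_sum]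
    have h3 : ∑ v ∈ Finset.univ.erase u,
        (((uniformEdges n s).filter (fun e => u ∈ e ∧ v ∈ e)).card : ℝ) * x v =
        ∑ v ∈ Finset.univ.erase u, ((n - 2).choose (s - 2) : ℝ) * x v := by
      refine Finset.sum_congr rfl fun v hv => ?_
      rw [card_uniformEdges_pair hs (Finset.ne_of_mem_erase hv).symm]
    rw [h3]
    simp only [and_self]
    rw [card_uniformEdges_mem (by omega), hsplit]
    ring
  have h4 : ∑ e ∈ uniformEdges n s, (∑ v ∈ e, x v) ^ 2 =
      ((n - 2).choose (s - 1) : ℝ) * ∑ v, x v ^ 2 +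
        ((n - 2).choose (s - 2) : ℝ) * (∑ v, x v) ^ 2 := by
    have h5 := sum_mul_sum_filter_mem (s := s) x (fun e => ∑ v ∈ e, x v)
    simp_rw [hrow] at h5
    simp_rw [sq, ← h5, mul_add, Finset.sum_add_distrib, Finset.mul_sum]
    congr 1
    · exact Finset.sum_congr rfl fun v _ => by ring
    · simp_rw [← Finset.mul_sum, ← Finset.sum_mul]
      ring
  rw [h4]
  have : 0 ≤ ((n - 2).choose (s - 2) : ℝ) * (∑ v, x v) ^ 2 := by positivity
  linarith

/-! ### Injectivity of the expected degrees -/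

theorem expectedDegree_sub_mul {n s : ℕ} (β x : Fin n → ℝ) :
    ∑ v, x v * (expectedDegree s (β + x) v - expectedDegree s β v) =
      ∑ e ∈ uniformEdges n s, (edgeProb (β + x) e - edgeProb β e) * ∑ v ∈ e, x v := by
  simp_rw [expectedDegree, ← Finset.sum_sub_distrib]
  exact sum_mul_sum_filter_mem _ _

/-- Equal degrees make a sum of nonnegative edge terms vanish, so every edge sum of the difference
is zero and `sum_sq_edges_ge` applies. For `n = s` there is a single edge and the claim fails. -/
theorem expectedDegree_injective {n s : ℕ} (hs : 2 ≤ s) (hn : s + 1 ≤ n) :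
    Function.Injective (expectedDegree (n := n) s) := by
  intro β γ h
  obtain ⟨x, rfl⟩ : ∃ x, γ = β + x := ⟨γ - β, by simp⟩
  have h0 := expectedDegree_sub_mul (s := s) β x
  simp only [← h, sub_self, mul_zero, Finset.sum_const_zero] at h0
  have key (e : Finset (Fin n)) : 0 ≤ (edgeProb (β + x) e - edgeProb β e) * ∑ v ∈ e, x v ∧
      ((edgeProb (β + x) e - edgeProb β e) * ∑ v ∈ e, x v = 0 → ∑ v ∈ e, x v = 0) := by
    simp only [edgeProb_eq_logistic, Pi.add_apply, Finset.sum_add_distrib]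
    rcases lt_trichotomy (∑ v ∈ e, x v) 0 with hx | hx | hx
    · have := logistic_strictMono (add_lt_of_neg_right (∑ v ∈ e, β v) hx)
      have := mul_pos_of_neg_of_neg (sub_neg.2 this) hx
      exact ⟨this.le, fun h => absurd h this.ne'⟩
    · simp [hx]
    · have := logistic_strictMono (lt_add_of_pos_right (∑ v ∈ e, β v) hx)
      have := mul_pos (sub_pos.2 this) hx
      exact ⟨this.le, fun h => absurd h this.ne'⟩
  have h1 := (Finset.sum_eq_zero_iff_of_nonneg fun e _ => (key e).1).1 h0.symm
  have h2 := sum_sq_edges_ge hs (by omega) x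
  rw [Finset.sum_eq_zero (s := uniformEdges n s) fun e he => by
    rw [(key e).2 (h1 e he), sq, zero_mul]] at h2
  have h3 : 0 < ((n - 2).choose (s - 1) : ℝ) := by
    exact_mod_cast Nat.choose_pos (by omega)
  have h4 : ∑ v, x v ^ 2 ≤ 0 := by
    by_contra! h5
    have := mul_pos h3 h5
    linarith
  have h6 := (Finset.sum_eq_zero_iff_of_nonneg fun v _ => sq_nonneg (x v)).1
    (le_antisymm h4 (Finset.sum_nonneg fun v _ => sq_nonneg (x v)))
  have h7 : x = 0 := by
    ext v
    simpa using h6 v (Finset.mem_univ v)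
  simp [h7]

/-! ### A minimiser of the negative log-likelihood over a box -/

/-- One-sided, because the minimiser may lie on a face of the box. -/
theorem deriv_nonpos_of_min_left {h : ℝ → ℝ} {G a t : ℝ} (hd : HasDerivAt h G t) (hat : a < t)
    (hmin : ∀ y ∈ Set.Ioo a t, h t ≤ h y) : G ≤ 0 := by
  have h1 := hasDerivAt_iff_tendsto_slope.1 hd
  have h2 := h1.mono_left (nhdsWithin_mono t (fun y (hy : y < t) => hy.ne) : 𝓝[<] t ≤ 𝓝[≠] t)
  refine le_of_tendsto h2 ?_
  filter_upwards [Ioo_mem_nhdsLT hat] with y hy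
  rw [slope_def_field]
  exact div_nonpos_of_nonneg_of_nonpos (sub_nonneg.2 (hmin y hy)) (sub_nonpos.2 hy.2.le)

theorem deriv_nonneg_of_min_right {h : ℝ → ℝ} {G t b : ℝ} (hd : HasDerivAt h G t) (htb : t < b)
    (hmin : ∀ y ∈ Set.Ioo t b, h t ≤ h y) : 0 ≤ G := by
  have h1 := hasDerivAt_iff_tendsto_slope.1 hd
  have h2 := h1.mono_left (nhdsWithin_mono t (fun y (hy : t < y) => hy.ne') : 𝓝[>] t ≤ 𝓝[≠] t)
  refine ge_of_tendsto h2 ?_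
  filter_upwards [Ioo_mem_nhdsGT htb] with y hy
  rw [slope_def_field]
  exact div_nonneg (sub_nonneg.2 (hmin y hy)) (sub_nonneg.2 hy.1.le)

/-- The negative log-likelihood of one layer with degree sequence `d`. -/
noncomputable def negLogLikelihood {n : ℕ} (s : ℕ) (d β : Fin n → ℝ) : ℝ :=
  ∑ e ∈ uniformEdges n s, Real.log (1 + Real.exp (∑ v ∈ e, β v)) - ∑ v, d v * β v

theorem continuous_negLogLikelihood {n : ℕ} (s : ℕ) (d : Fin n → ℝ) :
    Continuous (negLogLikelihood s d) := by
  unfold negLogLikelihood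
  refine Continuous.sub (continuous_finsetSum _ fun e _ => ?_) (by fun_prop)
  exact Continuous.log (by fun_prop) fun β => by positivity

theorem hasDerivAt_negLogLikelihood {n : ℕ} (s : ℕ) (d β : Fin n → ℝ) (v : Fin n) :
    HasDerivAt (fun t => negLogLikelihood s d (β + Pi.single v t)) (expectedDegree s β v - d v)
      0 := by
  have hs (e : Finset (Fin n)) (t : ℝ) : ∑ u ∈ e, (β + Pi.single v t : Fin n → ℝ) u =
      ∑ u ∈ e, β u + if v ∈ e then t else 0 := by
    simp [Finset.sum_add_distrib]
  have hd (t : ℝ) : ∑ u, d u * (β + Pi.single v t : Fin n → ℝ) u = ∑ u, d u * β u + d v * t := by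
    simp [mul_add, Finset.sum_add_distrib, Pi.single_apply]
  simp only [negLogLikelihood, hs, hd, expectedDegree]
  rw [Finset.sum_filter]
  refine HasDerivAt.sub (HasDerivAt.fun_sum fun e _ => ?_) ?_
  · by_cases hv : v ∈ e
    · simp only [hv, if_true]
      have h := hasDerivAt_softplus (∑ u ∈ e, β u + 0)
      have h2 := HasDerivAt.comp_const_add (∑ u ∈ e, β u) 0 h
      simpa [edgeProb_eq_logistic] using h2
    · simp only [hv, if_false]
      exact hasDerivAt_const _ _
  · simpa using ((hasDerivAt_id (0 : ℝ)).const_mul (d v)).const_add (∑ u, d u * β u)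

/-- First-order conditions for a minimiser over a box: a coordinate that has room to move in one
direction fixes one sign of the partial derivative. For arbitrary `d` an unconstrained minimiser
need not exist. -/
theorem exists_box_critical {n : ℕ} (s : ℕ) (d β : Fin n → ℝ) :
    ∃ x : Fin n → ℝ, (∀ v, |x v| ≤ 1) ∧
      (∀ v, -1 < x v → expectedDegree s (β + x) v ≤ d v) ∧
      (∀ v, x v < 1 → d v ≤ expectedDegree s (β + x) v) := by
  obtain ⟨x, hx, hmin⟩ := (isCompact_Icc (a := fun _ : Fin n => (-1 : ℝ))
    (b := fun _ => 1)).exists_isMinOn ⟨0, by constructor <;> intro <;> simp⟩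
    ((continuous_negLogLikelihood s d).comp (continuous_const_add β)).continuousOn
  have hmin' (v : Fin n) (t : ℝ) (h1 : -1 ≤ x v + t) (h2 : x v + t ≤ 1) :
      negLogLikelihood s d (β + x + Pi.single v 0) ≤
        negLogLikelihood s d (β + x + Pi.single v t) := by
    have h3 : x + Pi.single v t ∈ Set.Icc (fun _ : Fin n => (-1 : ℝ)) (fun _ => 1) := by
      constructor <;> intro u <;> rcases eq_or_ne u v with rfl | hu
      · simpa using h1
      · simpa [hu] using hx.1 u
      · simpa using h2
      · simpa [hu] using hx.2 u
    have h4 := isMinOn_iff.1 hmin _ h3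
    simpa [add_assoc] using h4
  refine ⟨x, fun v => abs_le.2 ⟨hx.1 v, hx.2 v⟩, fun v hv => ?_, fun v hv => ?_⟩
  · have := deriv_nonpos_of_min_left (a := -1 - x v)
      (hasDerivAt_negLogLikelihood s d (β + x) v) (by linarith)
      fun t ht => hmin' v t (by linarith [ht.1]) (by linarith [ht.2, hx.2 v])
    linarith
  · have := deriv_nonneg_of_min_right (b := 1 - x v)
      (hasDerivAt_negLogLikelihood s d (β + x) v) (by linarith)
      fun t ht => hmin' v t (by linarith [ht.1, hx.1 v]) (by linarith [ht.2])
    linarith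

/-! ### Error bounds for the critical point in the box -/

/-- A lower bound for `(n - 2).choose (s - 1) / n ^ (s - 1)` for `n ≥ 2 * s`. -/
noncomputable def chooseConst (s : ℕ) : ℝ := (1 / 2) ^ (s - 1) / (s - 1).factorial

theorem chooseConst_pos (s : ℕ) : 0 < chooseConst s := by
  unfold chooseConst
  positivity

theorem chooseConst_mul_le {n s : ℕ} (hs : 2 ≤ s) (hn : 2 * s ≤ n) :
    chooseConst s * (n : ℝ) ^ (s - 1) ≤ ((n - 2).choose (s - 1) : ℝ) := by
  refine le_trans ?_ (Nat.pow_le_choose (s - 1) (n - 2))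
  rw [chooseConst, div_mul_eq_mul_div, ← mul_pow]
  have h1 : (1 / 2 : ℝ) * n ≤ ((n - 2 + 1 - (s - 1) : ℕ) : ℝ) := by
    -- The base is `n - s`, the smallest factor in the falling factorial; it is at least `n / 2`
    -- because `2 * s ≤ n`.
    have h2 : n ≤ 2 * (n - 2 + 1 - (s - 1)) := by omega
    have h3 : (n : ℝ) ≤ 2 * ((n - 2 + 1 - (s - 1) : ℕ) : ℝ) := by exact_mod_cast h2
    linarith
  gcongr

theorem abs_sum_le_card_mul {n : ℕ} {e : Finset (Fin n)} {x : Fin n → ℝ} {K : ℝ}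
    (hx : ∀ v, |x v| ≤ K) : |∑ v ∈ e, x v| ≤ e.card * K := by
  refine (Finset.abs_sum_le_sum_abs _ _).trans ?_
  simpa using Finset.sum_le_card_nsmul e (fun v => |x v|) K fun v _ => hx v

/-- Strong monotonicity of the gradient on the box, where all edge sums lie in `[-s(M+1), s(M+1)]`.
-/
theorem sum_sq_le_sum_mul_expectedDegree_sub {n s : ℕ} (hs : 2 ≤ s) (hn : 2 * s ≤ n) {M : ℝ}
    {β x : Fin n → ℝ} (hβ : ∀ v, |β v| ≤ M) (hx : ∀ v, |x v| ≤ 1) :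
    logisticSlope (s * (M + 1)) * chooseConst s * (n : ℝ) ^ (s - 1) * ∑ v, x v ^ 2 ≤
      ∑ v, x v * (expectedDegree s (β + x) v - expectedDegree s β v) := by
  have hc := logisticSlope_pos (s * (M + 1))
  rw [expectedDegree_sub_mul]
  have h1 : logisticSlope (s * (M + 1)) * ∑ e ∈ uniformEdges n s, (∑ v ∈ e, x v) ^ 2 ≤
      ∑ e ∈ uniformEdges n s, (edgeProb (β + x) e - edgeProb β e) * ∑ v ∈ e, x v := by
    rw [Finset.mul_sum]
    refine Finset.sum_le_sum fun e he => ?_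
    rw [mem_uniformEdges] at he
    have hb : |∑ v ∈ e, β v| ≤ s * (M + 1) :=
      (abs_sum_le_card_mul (e := e) (K := M + 1) fun v => (hβ v).trans (by linarith)).trans_eq
        (by rw [he])
    have hbx : |∑ v ∈ e, (β + x) v| ≤ s * (M + 1) :=
      (abs_sum_le_card_mul (e := e) fun v =>
        (abs_add_le _ _).trans (add_le_add (hβ v) (hx v))).trans_eq (by rw [he])
    have h2 := logisticSlope_mul_sq_le hb hbx
    have h3 : ∑ v ∈ e, (β + x) v - ∑ v ∈ e, β v = ∑ v ∈ e, x v := by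
      simp [Finset.sum_add_distrib]
    rw [h3] at h2
    exact h2
  have h4 := (mul_le_mul_of_nonneg_right (chooseConst_mul_le hs hn)
    (Finset.sum_nonneg fun v _ => sq_nonneg (x v))).trans (sum_sq_edges_ge hs (by omega) x)
  have h5 := mul_le_mul_of_nonneg_left h4 hc.le
  linarith

/-- Any other vertex shares at most `n^(s-2)` edges with `v`; this bounds the influence of the other
coordinates on the degree of `v`. -/
theorem sum_abs_erase_le {n s : ℕ} (hs : 2 ≤ s) (x : Fin n → ℝ) (v : Fin n) :
    ∑ e ∈ uniformEdges n s with v ∈ e, |∑ u ∈ e.erase v, x u| ≤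
      (n : ℝ) ^ (s - 2) * ∑ u, |x u| := by
  calc ∑ e ∈ uniformEdges n s with v ∈ e, |∑ u ∈ e.erase v, x u|
      ≤ ∑ e ∈ uniformEdges n s with v ∈ e, ∑ u, if u ∈ e.erase v then |x u| else 0 := by
        refine Finset.sum_le_sum fun e _ => (Finset.abs_sum_le_sum_abs _ _).trans_eq ?_
        simp only [Finset.sum_ite_mem, Finset.univ_inter]
    _ = ∑ u, (((uniformEdges n s).filter
          (fun e => v ∈ e ∧ u ∈ e.erase v)).card : ℝ) * |x u| := by
        rw [Finset.sum_comm]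
        refine Finset.sum_congr rfl fun u _ => ?_
        rw [← Finset.sum_filter, Finset.filter_filter, Finset.sum_const, nsmul_eq_mul]
    _ ≤ ∑ u, (n : ℝ) ^ (s - 2) * |x u| := by
        refine Finset.sum_le_sum fun u _ => mul_le_mul_of_nonneg_right ?_ (abs_nonneg _)
        rcases eq_or_ne u v with rfl | huv
        · simp
        · have h1 : (uniformEdges n s).filter (fun e => v ∈ e ∧ u ∈ e.erase v) =
              (uniformEdges n s).filter (fun e => v ∈ e ∧ u ∈ e) := by
            refine Finset.filter_congr fun e _ => ?_
            simp [huv]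
          rw [h1, card_uniformEdges_pair hs huv.symm]
          have h2 : (n - 2).choose (s - 2) ≤ n ^ (s - 2) :=
            (Nat.choose_le_pow _ _).trans (Nat.pow_le_pow_left (by omega) _)
          exact_mod_cast h2
    _ = _ := by rw [Finset.mul_sum]

/-- Complementing the hypergraph negates the parameters; this reduces negative `x v` to positive
ones. -/
theorem expectedDegree_neg {n s : ℕ} (β : Fin n → ℝ) (v : Fin n) :
    expectedDegree s (-β) v = ((uniformEdges n s).filter (v ∈ ·)).card - expectedDegree s β v := by
  have h (e : Finset (Fin n)) : edgeProb (-β) e = 1 - edgeProb β e := by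
    simp only [edgeProb, Pi.neg_apply, Finset.sum_neg_distrib, Real.exp_neg]
    have := Real.exp_pos (∑ u ∈ e, β u)
    field_simp
    ring
  simp_rw [expectedDegree, h, Finset.sum_sub_distrib]
  simp

/-- On each edge at `v`, `β` is moved to `β + x` in two steps: changing coordinate `v` alone gains
at least the slope bound, and changing the others loses at most their sum, as `logistic` is
1-Lipschitz. -/
theorem mul_le_expectedDegree_sub {n s : ℕ} (hs : 2 ≤ s) (hn : 2 * s ≤ n) {M : ℝ}
    {β x : Fin n → ℝ} (hβ : ∀ v, |β v| ≤ M) (hx : ∀ v, |x v| ≤ 1) (v : Fin n) (hv : 0 ≤ x v) :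
    logisticSlope (s * (M + 1)) * chooseConst s * (n : ℝ) ^ (s - 1) * x v ≤
      expectedDegree s (β + x) v - expectedDegree s β v + (n : ℝ) ^ (s - 2) * ∑ u, |x u| := by
  set c := logisticSlope (s * (M + 1)) with hc
  have hc0 : 0 < c := logisticSlope_pos _
  have hedge (e : Finset (Fin n)) (he : e ∈ (uniformEdges n s).filter (v ∈ ·)) :
      c * x v - |∑ u ∈ e.erase v, x u| ≤ edgeProb (β + x) e - edgeProb β e := by
    rw [Finset.mem_filter, mem_uniformEdges] at he
    have hb : |∑ u ∈ e, β u| ≤ s * M := (abs_sum_le_card_mul hβ).trans_eq (by rw [he.1])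
    rw [abs_le] at hb
    have hs1 : (1 : ℝ) ≤ s := by exact_mod_cast (by omega : 1 ≤ s)
    have hxv := (abs_le.1 (hx v)).2
    have h1 := logisticSlope_mul_le (L := s * (M + 1)) (a := ∑ u ∈ e, β u)
      (b := ∑ u ∈ e, β u + x v) (by linarith) (by linarith) (by linarith)
    have h2 := abs_logistic_sub_le (∑ u ∈ e, β u + x v) (∑ u ∈ e, (β + x) u)
    have h3 : ∑ u ∈ e, (β + x) u = ∑ u ∈ e, β u + x v + ∑ u ∈ e.erase v, x u := by
      rw [add_assoc, Finset.add_sum_erase _ _ he.2]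
      simp [Finset.sum_add_distrib]
    rw [h3, add_sub_cancel_left, ← h3] at h2
    rw [add_sub_cancel_left] at h1
    have h4 := (abs_le.1 h2).1
    rw [edgeProb_eq_logistic, edgeProb_eq_logistic]
    linarith
  have h5 := Finset.sum_le_sum hedge
  rw [Finset.sum_sub_distrib, Finset.sum_sub_distrib, Finset.sum_const, nsmul_eq_mul,
    card_uniformEdges_mem (by omega)] at h5
  have h6 := sum_abs_erase_le hs x v
  have h7 : chooseConst s * (n : ℝ) ^ (s - 1) ≤ ((n - 1).choose (s - 1) : ℝ) :=
    (chooseConst_mul_le hs hn).trans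
      (by exact_mod_cast Nat.choose_le_choose (s - 1) (by omega : n - 2 ≤ n - 1))
  have h8 := mul_le_mul_of_nonneg_right h7 (mul_nonneg hc0.le hv)
  unfold expectedDegree
  linarith

theorem mul_abs_le_of_critical {n s : ℕ} (hs : 2 ≤ s) (hn : 2 * s ≤ n) {M : ℝ}
    {d β x : Fin n → ℝ} (hβ : ∀ v, |β v| ≤ M) (hx : ∀ v, |x v| ≤ 1)
    (hlow : ∀ v, -1 < x v → expectedDegree s (β + x) v ≤ d v)
    (hhigh : ∀ v, x v < 1 → d v ≤ expectedDegree s (β + x) v) (v : Fin n) :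
    logisticSlope (s * (M + 1)) * chooseConst s * (n : ℝ) ^ (s - 1) * |x v| ≤
      |d v - expectedDegree s β v| + (n : ℝ) ^ (s - 2) * ∑ u, |x u| := by
  rcases le_total 0 (x v) with hv | hv
  · have h1 := mul_le_expectedDegree_sub hs hn hβ hx v hv
    have h2 := hlow v (by linarith)
    rw [abs_of_nonneg hv]
    have := le_abs_self (d v - expectedDegree s β v)
    linarith
  · have h1 := mul_le_expectedDegree_sub hs hn (β := -β) (x := -x)
      (by simpa using hβ) (by simpa using hx) v (by simpa using hv)
    rw [← neg_add, expectedDegree_neg, expectedDegree_neg] at h1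
    simp only [Pi.neg_apply, abs_neg] at h1
    have h2 := hhigh v (by linarith)
    rw [abs_of_nonpos hv]
    have := neg_le_abs (d v - expectedDegree s β v)
    linarith

/-- The constant of the `L_2` bound. -/
noncomputable def l2Const (s : ℕ) (M : ℝ) : ℝ :=
  Real.sqrt 2 / (logisticSlope (s * (M + 1)) * chooseConst s)

theorem l2Const_pos (s : ℕ) (M : ℝ) : 0 < l2Const s M := by
  have := logisticSlope_pos (s * (M + 1))
  have := chooseConst_pos s
  unfold l2Const
  positivity

theorem l2norm_le_of_critical {n s : ℕ} (hs : 2 ≤ s) (hn : 2 * s ≤ n) {M : ℝ}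
    {d β x : Fin n → ℝ} (hβ : ∀ v, |β v| ≤ M) (hx : ∀ v, |x v| ≤ 1)
    (hlow : ∀ v, -1 < x v → expectedDegree s (β + x) v ≤ d v)
    (hhigh : ∀ v, x v < 1 → d v ≤ expectedDegree s (β + x) v)
    (hg : ∑ v, (d v - expectedDegree s β v) ^ 2 ≤ 2 * (n : ℝ) ^ s) :
    l2norm x ≤ l2Const s M * Real.sqrt (1 / (n : ℝ) ^ (s - 2)) := by
  set a := logisticSlope (s * (M + 1)) * chooseConst s with ha
  have ha0 : 0 < a := mul_pos (logisticSlope_pos _) (chooseConst_pos _)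
  have hn0 : (0 : ℝ) < n := by exact_mod_cast (by omega : 0 < n)
  have h1 := sum_sq_le_sum_mul_expectedDegree_sub hs hn hβ hx
  rw [← ha] at h1
  -- The one-sided equation available at `v` is the one matching the sign of `x v`, even on the
  -- boundary of the box.
  have h2 : ∑ v, x v * (expectedDegree s (β + x) v - expectedDegree s β v) ≤
      ∑ v, x v * (d v - expectedDegree s β v) := by
    refine Finset.sum_le_sum fun v _ => ?_
    rcases le_total 0 (x v) with hv | hv
    · exact mul_le_mul_of_nonneg_left (by linarith [hlow v (by linarith)]) hv
    · exact mul_le_mul_of_nonpos_left (by linarith [hhigh v (by linarith)]) hv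
  have h3 := Real.sum_mul_le_sqrt_mul_sqrt Finset.univ x (fun v => d v - expectedDegree s β v)
  have h4 := mul_le_mul_of_nonneg_left (Real.sqrt_le_sqrt hg) (Real.sqrt_nonneg (∑ v, x v ^ 2))
  have h5 : a * (n : ℝ) ^ (s - 1) * ∑ v, x v ^ 2 ≤ l2norm x * Real.sqrt (2 * (n : ℝ) ^ s) :=
    h1.trans (h2.trans (h3.trans h4))
  have h6 : ∑ v, x v ^ 2 = l2norm x * l2norm x :=
    (Real.mul_self_sqrt (Finset.sum_nonneg fun v _ => sq_nonneg (x v))).symm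
  rcases (Real.sqrt_nonneg (∑ v, x v ^ 2)).eq_or_lt with h0 | h0
  · have : l2norm x = 0 := h0.symm
    rw [this]
    have := l2Const_pos s M
    positivity
  · have h0' : 0 < l2norm x := h0
    rw [h6] at h5
    have h7 : a * (n : ℝ) ^ (s - 1) * l2norm x ≤ Real.sqrt (2 * (n : ℝ) ^ s) := by
      refine le_of_mul_le_mul_left ?_ h0'
      linarith
    have h8 : Real.sqrt (2 * (n : ℝ) ^ s) =
        Real.sqrt 2 * ((n : ℝ) ^ (s - 1) * Real.sqrt (1 / (n : ℝ) ^ (s - 2))) := by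
      rw [Real.sqrt_mul zero_le_two]
      congr 1
      rw [← Real.sqrt_sq (by positivity : (0 : ℝ) ≤ n ^ (s - 1)), ← Real.sqrt_mul (by positivity)]
      congr 1
      rw [mul_one_div, eq_div_iff (by positivity), ← pow_add, ← pow_mul]
      congr 1
      omega
    rw [h8] at h7
    rw [l2Const, ← ha, div_mul_eq_mul_div, le_div_iff₀ ha0]
    have hp : 0 < (n : ℝ) ^ (s - 1) := by positivity
    refine le_of_mul_le_mul_left ?_ hp
    linarith

/-- The constant of the `L_∞` bound. -/
noncomputable def linftyConst (s : ℕ) (M : ℝ) : ℝ :=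
  (1 + l2Const s M) / (logisticSlope (s * (M + 1)) * chooseConst s)

theorem linftyConst_pos (s : ℕ) (M : ℝ) : 0 < linftyConst s M := by
  have := logisticSlope_pos (s * (M + 1))
  have := chooseConst_pos s
  have := l2Const_pos s M
  unfold linftyConst
  positivity

theorem abs_le_of_critical {n s : ℕ} (hs : 2 ≤ s) (hn : 2 * s ≤ n) {M : ℝ}
    {d β x : Fin n → ℝ} (hβ : ∀ v, |β v| ≤ M) (hx : ∀ v, |x v| ≤ 1)
    (hlow : ∀ v, -1 < x v → expectedDegree s (β + x) v ≤ d v)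
    (hhigh : ∀ v, x v < 1 → d v ≤ expectedDegree s (β + x) v)
    (hg : ∑ v, (d v - expectedDegree s β v) ^ 2 ≤ 2 * (n : ℝ) ^ s)
    (hg' : ∀ v, |d v - expectedDegree s β v| ≤ Real.sqrt ((n : ℝ) ^ (s - 1) * Real.log n))
    (v : Fin n) :
    |x v| ≤ linftyConst s M * Real.sqrt (Real.log n / (n : ℝ) ^ (s - 1)) := by
  set a := logisticSlope (s * (M + 1)) * chooseConst s with ha
  have ha0 : 0 < a := mul_pos (logisticSlope_pos _) (chooseConst_pos _)
  have hn0 : (0 : ℝ) < n := by exact_mod_cast (by omega : 0 < n)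
  have hlog : 1 ≤ Real.log n := by
    rw [Real.le_log_iff_exp_le hn0]
    have h4 : (4 : ℝ) ≤ n := by exact_mod_cast (by omega : 4 ≤ n)
    linarith [Real.exp_one_lt_d9]
  have h1 := mul_abs_le_of_critical hs hn hβ hx hlow hhigh v
  rw [← ha] at h1
  have h2 : ∑ u, |x u| ≤ Real.sqrt n * l2norm x := by
    have := Real.sum_mul_le_sqrt_mul_sqrt Finset.univ (fun _ : Fin n => (1 : ℝ)) (fun u => |x u|)
    simpa [l2norm] using this
  have h3 := l2norm_le_of_critical hs hn hβ hx hlow hhigh hg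
  set S := Real.sqrt ((n : ℝ) ^ (s - 1) * Real.log n) with hS
  have hS0 : 0 ≤ S := Real.sqrt_nonneg _
  -- The left side is `n^((s-1)/2)`, so the cross term is absorbed once `log n ≥ 1`.
  have h4 : (n : ℝ) ^ (s - 2) * (Real.sqrt n * Real.sqrt (1 / (n : ℝ) ^ (s - 2))) ≤ S := by
    rw [hS, ← Real.sqrt_mul hn0.le, ← Real.sqrt_sq (by positivity : (0 : ℝ) ≤ n ^ (s - 2)),
      ← Real.sqrt_mul (by positivity)]
    refine Real.sqrt_le_sqrt ?_
    rw [mul_one_div, Real.sqrt_sq (by positivity), ← mul_div_assoc, div_le_iff₀ (by positivity)]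
    have h5 : ((n : ℝ) ^ (s - 2)) ^ 2 * n = (n : ℝ) ^ (s - 1) * 1 * (n : ℝ) ^ (s - 2) := by
      rw [mul_one, ← pow_mul, ← pow_succ, ← pow_add]
      congr 1
      omega
    rw [h5]
    gcongr
  have h6 : (n : ℝ) ^ (s - 2) * ∑ u, |x u| ≤ l2Const s M * S := by
    calc (n : ℝ) ^ (s - 2) * ∑ u, |x u|
        ≤ (n : ℝ) ^ (s - 2) *
          (Real.sqrt n * (l2Const s M * Real.sqrt (1 / (n : ℝ) ^ (s - 2)))) := by
          gcongr
          exact h2.trans (by gcongr)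
      _ = l2Const s M *
          ((n : ℝ) ^ (s - 2) * (Real.sqrt n * Real.sqrt (1 / (n : ℝ) ^ (s - 2)))) := by ring
      _ ≤ _ := mul_le_mul_of_nonneg_left h4 (l2Const_pos s M).le
  have hp : 0 < (n : ℝ) ^ (s - 1) := by positivity
  have h7 : S = (n : ℝ) ^ (s - 1) * Real.sqrt (Real.log n / (n : ℝ) ^ (s - 1)) := by
    rw [hS]
    nth_rewrite 2 [← Real.sqrt_sq hp.le]
    rw [← Real.sqrt_mul (by positivity)]
    congr 1
    field_simp
  have h8 : a * (n : ℝ) ^ (s - 1) * |x v| ≤ (1 + l2Const s M) * S := by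
    linarith [hg' v]
  rw [h7] at h8
  rw [linftyConst, ← ha, div_mul_eq_mul_div, le_div_iff₀ ha0]
  refine le_of_mul_le_mul_left ?_ hp
  linarith

/-! ### From the critical point in the box to the global solution -/

theorem eventually_linftyConst_mul_lt_one {s : ℕ} (hs : 2 ≤ s) (M : ℝ) :
    ∀ᶠ n : ℕ in atTop,
      linftyConst s M * Real.sqrt (Real.log n / (n : ℝ) ^ (s - 1)) < 1 := by
  have h1 : Tendsto (fun n : ℕ => Real.log n / (n : ℝ) ^ (s - 1)) atTop (𝓝 0) := by
    have h2 : Tendsto (fun x : ℝ => Real.log x / x ^ (s - 1)) atTop (𝓝 0) := by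
      have h3 := isLittleO_log_rpow_atTop (r := ((s - 1 : ℕ) : ℝ))
        (by exact_mod_cast (by omega : 0 < s - 1))
      simpa using h3.tendsto_div_nhds_zero
    exact h2.comp tendsto_natCast_atTop_atTop
  have h4 := (h1.sqrt).const_mul (linftyConst s M)
  rw [Real.sqrt_zero, mul_zero] at h4
  exact h4.eventually_lt_const one_pos

/-- The likelihood equations of one layer with degree sequence `d` have a unique solution, and it
is close to `β`, provided that `d` is close to the expected degree sequence under `β`. -/
theorem eventually_existsUnique_expectedDegree_eq {s : ℕ} (hs : 2 ≤ s) (M : ℝ) :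
    ∀ᶠ n : ℕ in atTop, ∀ d β : Fin n → ℝ, (∀ v, |β v| ≤ M) →
      ∑ v, (d v - expectedDegree s β v) ^ 2 ≤ 2 * (n : ℝ) ^ s →
      (∀ v, |d v - expectedDegree s β v| ≤ Real.sqrt ((n : ℝ) ^ (s - 1) * Real.log n)) →
      ∃ γ : Fin n → ℝ, (∀ γ', (∀ v, d v = expectedDegree s γ' v) ↔ γ' = γ) ∧
        l2norm (γ - β) ≤ l2Const s M * Real.sqrt (1 / (n : ℝ) ^ (s - 2)) ∧
        ‖γ - β‖ ≤ linftyConst s M * Real.sqrt (Real.log n / (n : ℝ) ^ (s - 1)) := by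
  filter_upwards [eventually_ge_atTop (2 * s), eventually_linftyConst_mul_lt_one hs M] with
    n hn hlt d β hβ hg hg'
  obtain ⟨x, hx, hlow, hhigh⟩ := exists_box_critical s d β
  have h1 := abs_le_of_critical hs hn hβ hx hlow hhigh hg hg'
  have hsol : d = expectedDegree s (β + x) := by
    ext v
    -- Strictly inside the box both one-sided equations hold, so they combine to equality.
    have h2 := abs_lt.1 ((h1 v).trans_lt hlt)
    exact le_antisymm (hhigh v h2.2) (hlow v h2.1)
  refine ⟨β + x, fun γ' => ⟨fun h => ?_, ?_⟩, ?_, ?_⟩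
  · exact expectedDegree_injective hs (by omega) ((funext h).symm.trans hsol)
  · rintro rfl v
    rw [← hsol]
  · rw [add_sub_cancel_left]
    exact l2norm_le_of_critical hs hn hβ hx hlow hhigh hg
  · rw [add_sub_cancel_left, pi_norm_le_iff_of_nonneg]
    · exact h1
    · exact mul_nonneg (linftyConst_pos s M).le (Real.sqrt_nonneg _)

/-! ### Quadratic forms in independent centred variables -/

section QuadraticForm

open ProbabilityTheory

/-- The off-diagonal part of the quadratic form `∑ e ∈ T, ∑ f ∈ T, a e f * x e * x f`. -/
def offDiagForm {ι : Type*} (a : ι → ι → ℝ) (T : Finset ι) (x : ι → ℝ) : ℝ :=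
  ∑ e ∈ T, ∑ f ∈ T, a e f * x e * x f - ∑ e ∈ T, a e e * x e ^ 2

/-- With independent centred entries the increment is a martingale difference, which drives the
induction in `integral_sq_offDiagForm_le`. -/
theorem offDiagForm_insert {ι : Type*} [DecidableEq ι] {a : ι → ι → ℝ}
    (ha : ∀ e f, a e f = a f e) {T : Finset ι} {k : ι} (hk : k ∉ T) (x : ι → ℝ) :
    offDiagForm a (insert k T) x = offDiagForm a T x + 2 * (x k * ∑ f ∈ T, a k f * x f) := by
  simp only [offDiagForm, Finset.sum_insert hk, Finset.sum_add_distrib]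
  have h1 : ∑ e ∈ T, a e k * x e * x k = x k * ∑ f ∈ T, a k f * x f := by
    rw [Finset.mul_sum]
    exact Finset.sum_congr rfl fun e _ => by rw [ha e k]; ring
  have h2 : ∑ f ∈ T, a k f * x k * x f = x k * ∑ f ∈ T, a k f * x f := by
    rw [Finset.mul_sum]
    exact Finset.sum_congr rfl fun e _ => by ring
  rw [h1, h2]
  ring

variable {Ω ι : Type*} [MeasurableSpace Ω] [Finite Ω] [MeasurableSingletonClass Ω]
  {P : Measure Ω} [IsProbabilityMeasure P] {X : ι → Ω → ℝ}

omit [IsProbabilityMeasure P] in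
theorem integral_mul_eq_zero_of_dependsOn [DecidableEq ι] (hX : iIndepFun X P) {k : ι}
    (h0 : ∫ ω, X k ω ∂P = 0) {T : Finset ι} (hk : k ∉ T) {G : (ι → ℝ) → ℝ} (hG : Measurable G)
    (hGT : DependsOn G T) : ∫ ω, X k ω * G (fun i => X i ω) ∂P = 0 := by
  have h1 := hX.indepFun_finset {k} T (by simpa using hk) fun i => measurable_of_finite (X i)
  -- Extension by zero presents `G` as a function of the `T`-coordinates only, so that independence
  -- of the blocks `{k}` and `T` applies.
  let ext (x : T → ℝ) (i : ι) : ℝ := if h : i ∈ T then x ⟨i, h⟩ else 0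
  have hext : Measurable ext := by
    refine measurable_pi_lambda _ fun i => ?_
    by_cases h : i ∈ T
    · simpa [ext, h] using measurable_pi_apply (⟨i, h⟩ : T)
    · simp [ext, h]
  have hev : Measurable fun x : ({k} : Finset ι) → ℝ => x ⟨k, Finset.mem_singleton_self k⟩ :=
    measurable_pi_apply _
  have h2 := h1.comp hev (hG.comp hext)
  have h3 (ω : Ω) : G (fun i => X i ω) = ((G ∘ ext) ∘ fun ω (i : T) => X i ω) ω := by
    refine hGT fun i hi => ?_
    have hi' : i ∈ T := hi
    simp [ext, hi']
  simp_rw [h3]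
  have h4 := h2.integral_fun_mul_eq_mul_integral (measurable_of_finite _).aestronglyMeasurable
    (measurable_of_finite _).aestronglyMeasurable
  refine h4.trans ?_
  simp only [Function.comp_apply, h0, zero_mul]

theorem integral_sq_sum_le [DecidableEq ι] (hX : iIndepFun X P) (h0 : ∀ i, ∫ ω, X i ω ∂P = 0)
    (h1 : ∀ i ω, |X i ω| ≤ 1) (b : ι → ℝ) (T : Finset ι) :
    ∫ ω, (∑ i ∈ T, b i * X i ω) ^ 2 ∂P ≤ ∑ i ∈ T, b i ^ 2 := by
  induction T using Finset.induction_on with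
  | empty => simp
  | insert k T hk ih =>
    simp only [Finset.sum_insert hk]
    have h2 : ∫ ω, X k ω * (∑ i ∈ T, b i * X i ω) ∂P = 0 :=
      integral_mul_eq_zero_of_dependsOn hX (h0 k) hk (G := fun x => ∑ i ∈ T, b i * x i)
        (by fun_prop) fun x y hxy => Finset.sum_congr rfl fun i hi => by rw [hxy i hi]
    calc ∫ ω, (b k * X k ω + ∑ i ∈ T, b i * X i ω) ^ 2 ∂P
        ≤ ∫ ω, (b k ^ 2 + 2 * b k * (X k ω * ∑ i ∈ T, b i * X i ω)
          + (∑ i ∈ T, b i * X i ω) ^ 2) ∂P := by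
          refine integral_mono .of_finite .of_finite fun ω => ?_
          have h3 : X k ω ^ 2 ≤ 1 := (sq_le_one_iff_abs_le_one _).2 (h1 k ω)
          have h4 := mul_le_mul_of_nonneg_left h3 (sq_nonneg (b k))
          dsimp only
          linarith
      _ = b k ^ 2 + ∫ ω, (∑ i ∈ T, b i * X i ω) ^ 2 ∂P := by
          rw [integral_add .of_finite .of_finite, integral_add .of_finite .of_finite,
            integral_const_mul, h2]
          simp
      _ ≤ _ := by linarith

/-- Adding an index `k`, the cross term integrates to zero and the squared increment costs at most
`4 * ∑ f ∈ T, a k f ^ 2`. -/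
theorem integral_sq_offDiagForm_le [DecidableEq ι] (hX : iIndepFun X P)
    (h0 : ∀ i, ∫ ω, X i ω ∂P = 0) (h1 : ∀ i ω, |X i ω| ≤ 1) {a : ι → ι → ℝ}
    (ha : ∀ e f, a e f = a f e) (T : Finset ι) :
    ∫ ω, offDiagForm a T (fun i => X i ω) ^ 2 ∂P ≤ 4 * ∑ e ∈ T, ∑ f ∈ T, a e f ^ 2 := by
  induction T using Finset.induction_on with
  | empty => simp [offDiagForm]
  | insert k T hk ih =>
    simp only [offDiagForm_insert ha hk]
    have h2 : ∫ ω, X k ω * (offDiagForm a T (fun i => X i ω) * ∑ f ∈ T, a k f * X f ω) ∂P = 0 := by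
      refine integral_mul_eq_zero_of_dependsOn hX (h0 k) hk
        (G := fun x => offDiagForm a T x * ∑ f ∈ T, a k f * x f) ?_ fun x y hxy => ?_
      · unfold offDiagForm
        fun_prop
      · have h3 : offDiagForm a T x = offDiagForm a T y := by
          unfold offDiagForm
          congr 1
          · exact Finset.sum_congr rfl fun e he => Finset.sum_congr rfl fun f hf => by
              rw [hxy e he, hxy f hf]
          · exact Finset.sum_congr rfl fun e he => by rw [hxy e he]
        dsimp only
        rw [h3]
        congr 1
        exact Finset.sum_congr rfl fun f hf => by rw [hxy f hf]
    have h5 := integral_sq_sum_le hX h0 h1 (a k) T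
    calc ∫ ω, (offDiagForm a T (fun i => X i ω) + 2 * (X k ω * ∑ f ∈ T, a k f * X f ω)) ^ 2 ∂P
        ≤ ∫ ω, (offDiagForm a T (fun i => X i ω) ^ 2
          + 4 * (X k ω * (offDiagForm a T (fun i => X i ω) * ∑ f ∈ T, a k f * X f ω))
          + 4 * (∑ f ∈ T, a k f * X f ω) ^ 2) ∂P := by
          refine integral_mono .of_finite .of_finite fun ω => ?_
          have h3 : X k ω ^ 2 ≤ 1 := (sq_le_one_iff_abs_le_one _).2 (h1 k ω)
          have h4 := mul_le_mul_of_nonneg_right h3 (sq_nonneg (∑ f ∈ T, a k f * X f ω))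
          dsimp only
          linarith
      _ = ∫ ω, offDiagForm a T (fun i => X i ω) ^ 2 ∂P
          + 4 * ∫ ω, (∑ f ∈ T, a k f * X f ω) ^ 2 ∂P := by
          rw [integral_add .of_finite .of_finite, integral_add .of_finite .of_finite,
            integral_const_mul, integral_const_mul, h2]
          simp
      _ ≤ 4 * ∑ e ∈ T, ∑ f ∈ T, a e f ^ 2 + 4 * ∑ f ∈ T, a k f ^ 2 := by linarith
      _ ≤ _ := by
          simp only [Finset.sum_insert hk, Finset.sum_add_distrib]
          have : 0 ≤ ∑ e ∈ T, a e k ^ 2 := Finset.sum_nonneg fun e _ => sq_nonneg _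
          have := sq_nonneg (a k k)
          linarith

end QuadraticForm

/-! ### Concentration of vertex sums -/

section VertexSums

open ProbabilityTheory

variable {ι V : Type*} [DecidableEq V]

theorem sum_card_inter_mul [Fintype V] (I : ι → Finset V) (T : Finset ι) (x : ι → ℝ) :
    ∑ e ∈ T, ∑ f ∈ T, ((I e ∩ I f).card : ℝ) * x e * x f =
      ∑ v, (∑ e ∈ T with v ∈ I e, x e) ^ 2 := by
  have h (e f : ι) : ((I e ∩ I f).card : ℝ) = ∑ v, if v ∈ I e ∩ I f then 1 else 0 := by
    rw [Finset.sum_boole, Finset.filter_mem_eq_inter, Finset.univ_inter]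
  simp_rw [h, sq, Finset.sum_filter, Finset.sum_mul_sum, Finset.sum_mul]
  rw [Finset.sum_comm (s := Finset.univ)]
  refine Finset.sum_congr rfl fun e _ => ?_
  rw [Finset.sum_comm]
  refine Finset.sum_congr rfl fun v _ => Finset.sum_congr rfl fun f _ => ?_
  by_cases he : v ∈ I e <;> by_cases hf : v ∈ I f <;> simp [he, hf]

theorem sum_card_inter [Fintype V] (I : ι → Finset V) (T : Finset ι) :
    ∑ e ∈ T, ∑ f ∈ T, ((I e ∩ I f).card : ℝ) =
      ∑ v, ((T.filter (v ∈ I ·)).card : ℝ) ^ 2 := by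
  simpa using sum_card_inter_mul I T 1

theorem sum_card_le [Fintype V] (I : ι → Finset V) (T : Finset ι) {D : ℝ}
    (hD : ∀ v, ((T.filter (v ∈ I ·)).card : ℝ) ≤ D) :
    ∑ e ∈ T, ((I e).card : ℝ) ≤ Fintype.card V * D := by
  have h (e : ι) : ((I e).card : ℝ) = ∑ v, if v ∈ I e then 1 else 0 := by simp
  simp_rw [h]
  rw [Finset.sum_comm]
  simp_rw [Finset.sum_boole]
  simpa using Finset.sum_le_card_nsmul Finset.univ _ D fun v _ => hD v

variable {Ω : Type*} [MeasurableSpace Ω] [Finite Ω] [MeasurableSingletonClass Ω]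
  {P : Measure Ω} [IsProbabilityMeasure P] {X : ι → Ω → ℝ}

/-- The squared `L_2` norm of the vector of vertex sums is of the order of its expectation with
high probability. -/
theorem measureReal_sum_sq_vertexSum_le [Fintype V] [Nonempty V] [DecidableEq ι]
    (hX : iIndepFun X P) (h0 : ∀ i, ∫ ω, X i ω ∂P = 0) (h1 : ∀ i ω, |X i ω| ≤ 1)
    (I : ι → Finset V) (T : Finset ι) {D k : ℝ} (hD0 : 0 < D) (hk0 : 0 ≤ k)
    (hD : ∀ v, ((T.filter (v ∈ I ·)).card : ℝ) ≤ D) (hk : ∀ e ∈ T, ((I e).card : ℝ) ≤ k) :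
    P.real {ω | 2 * (Fintype.card V * D) < ∑ v, (∑ e ∈ T with v ∈ I e, X e ω) ^ 2} ≤
      4 * k / Fintype.card V := by
  set a : ι → ι → ℝ := fun e f => ((I e ∩ I f).card : ℝ) with ha
  have hV : (0 : ℝ) < Fintype.card V := by exact_mod_cast Fintype.card_pos
  have h2 := integral_sq_offDiagForm_le hX h0 h1 (a := a)
    (fun e f => by simp only [ha, Finset.inter_comm]) T
  have h3 : ∑ e ∈ T, ∑ f ∈ T, a e f ^ 2 ≤ k * (Fintype.card V * D ^ 2) := by
    calc ∑ e ∈ T, ∑ f ∈ T, a e f ^ 2 ≤ ∑ e ∈ T, ∑ f ∈ T, k * a e f := by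
          refine Finset.sum_le_sum fun e he => Finset.sum_le_sum fun f _ => ?_
          rw [sq]
          refine mul_le_mul_of_nonneg_right (le_trans ?_ (hk e he)) (Nat.cast_nonneg _)
          exact Nat.cast_le.2 (Finset.card_le_card Finset.inter_subset_left)
      _ = k * ∑ v, ((T.filter (v ∈ I ·)).card : ℝ) ^ 2 := by
          simp_rw [← Finset.mul_sum]
          rw [sum_card_inter]
      _ ≤ k * (Fintype.card V * D ^ 2) := by
          refine mul_le_mul_of_nonneg_left ?_ hk0
          have := Finset.sum_le_card_nsmul Finset.univ
            (fun v => ((T.filter (v ∈ I ·)).card : ℝ) ^ 2) (D ^ 2) fun v _ =>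
              pow_le_pow_left₀ (Nat.cast_nonneg _) (hD v) 2
          simpa using this
  have h4 := mul_meas_ge_le_integral_of_nonneg (μ := P)
    (f := fun ω => offDiagForm a T (fun i => X i ω) ^ 2)
    (ae_of_all _ fun ω => sq_nonneg _) .of_finite ((Fintype.card V * D) ^ 2)
  have h5 : P.real {ω | 2 * (Fintype.card V * D) < ∑ v, (∑ e ∈ T with v ∈ I e, X e ω) ^ 2} ≤
      P.real {ω | (Fintype.card V * D) ^ 2 ≤ offDiagForm a T (fun i => X i ω) ^ 2} := by
    refine measureReal_mono fun ω hω => ?_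
    simp only [Set.mem_ofPred_eq] at hω ⊢
    refine pow_le_pow_left₀ (by positivity) ?_ 2
    -- The diagonal uses up at most half of the threshold for every `ω`; the off-diagonal part must
    -- exceed the other half.
    have h6 : ∑ e ∈ T, a e e * X e ω ^ 2 ≤ Fintype.card V * D := by
      refine le_trans (Finset.sum_le_sum fun e _ => ?_) (sum_card_le I T hD)
      have h7 : X e ω ^ 2 ≤ 1 := (sq_le_one_iff_abs_le_one _).2 (h1 e ω)
      simpa [ha] using mul_le_mul_of_nonneg_left h7 (Nat.cast_nonneg (α := ℝ) (I e).card)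
    rw [offDiagForm, sum_card_inter_mul]
    linarith
  refine h5.trans ?_
  rw [le_div_iff₀ hV]
  have h8 : 0 < Fintype.card V * D ^ 2 := by positivity
  refine le_of_mul_le_mul_right ?_ h8
  calc _ = (Fintype.card V * D) ^ 2 *
        P.real {ω | (Fintype.card V * D) ^ 2 ≤ offDiagForm a T (fun i => X i ω) ^ 2} := by ring
    _ ≤ 4 * ∑ e ∈ T, ∑ f ∈ T, a e f ^ 2 := h4.trans h2
    _ ≤ _ := by linarith

theorem measureReal_sum_gt_le (hX : iIndepFun X P) (h0 : ∀ i, ∫ ω, X i ω ∂P = 0)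
    {p : ι → ℝ} (hp : ∀ i ω, X i ω ∈ Set.Icc (-p i) (1 - p i)) (T : Finset ι) {D t : ℝ}
    (hD : (T.card : ℝ) ≤ D) (ht : 0 ≤ t) :
    P.real {ω | t < ∑ i ∈ T, X i ω} ≤ Real.exp (-(2 * t ^ 2 / D)) := by
  rcases T.eq_empty_or_nonempty with rfl | hT
  · simp only [Finset.sum_empty, not_lt.2 ht, Set.ofPred_false, measureReal_empty]
    positivity
  have hT0 : (0 : ℝ) < T.card := by exact_mod_cast hT.card_pos
  have h1 := HasSubgaussianMGF.measure_sum_ge_le_of_iIndepFun hX (s := T) (fun i _ =>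
    hasSubgaussianMGF_of_mem_Icc_of_integral_eq_zero (measurable_of_finite (X i)).aemeasurable
      (ae_of_all P (hp i)) (h0 i)) ht
  refine (measureReal_mono fun ω (hω : t < _) => hω.le).trans (h1.trans ?_)
  rw [Real.exp_le_exp]
  -- Hoeffding's variance proxy for an interval of length one.
  have h2 (i : ι) : ((‖1 - p i - -p i‖₊ / 2) ^ 2 : NNReal) = 1 / 4 := by
    rw [sub_neg_eq_add, sub_add_cancel, nnnorm_one]
    norm_num
  simp only [h2, Finset.sum_const, nsmul_eq_mul]
  push_cast
  rw [neg_div, neg_le_neg_iff]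
  calc 2 * t ^ 2 / D ≤ 2 * t ^ 2 / T.card := by gcongr
    _ = _ := by field_simp; ring

theorem measureReal_abs_sum_gt_le (hX : iIndepFun X P) (h0 : ∀ i, ∫ ω, X i ω ∂P = 0)
    {p : ι → ℝ} (hp : ∀ i ω, X i ω ∈ Set.Icc (-p i) (1 - p i)) (T : Finset ι) {D t : ℝ}
    (hD : (T.card : ℝ) ≤ D) (ht : 0 ≤ t) :
    P.real {ω | t < |∑ i ∈ T, X i ω|} ≤ 2 * Real.exp (-(2 * t ^ 2 / D)) := by
  have h1 := measureReal_sum_gt_le hX h0 hp T hD ht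
  have h2 := measureReal_sum_gt_le (P := P) (X := fun i ω => -X i ω) (p := fun i => 1 - p i)
    (hX.comp (fun _ x => -x) fun _ => measurable_neg)
    (fun i => by rw [integral_neg, h0, neg_zero])
    (fun i ω => ⟨by linarith [(hp i ω).2], by linarith [(hp i ω).1]⟩) T hD ht
  have h3 : {ω | t < |∑ i ∈ T, X i ω|} ⊆
      {ω | t < ∑ i ∈ T, X i ω} ∪ {ω | t < ∑ i ∈ T, -X i ω} := by
    intro ω hω
    simpa [lt_abs] using hω
  refine (measureReal_mono h3).trans ((measureReal_union_le _ _).trans ?_)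
  linarith

theorem measureReal_exists_abs_vertexSum_gt_le [Fintype V] (hX : iIndepFun X P)
    (h0 : ∀ i, ∫ ω, X i ω ∂P = 0)
    {p : ι → ℝ} (hp : ∀ i ω, X i ω ∈ Set.Icc (-p i) (1 - p i)) (I : ι → Finset V)
    (T : Finset ι) {D t : ℝ} (hD : ∀ v, ((T.filter (v ∈ I ·)).card : ℝ) ≤ D) (ht : 0 ≤ t) :
    P.real {ω | ∃ v, t < |∑ e ∈ T with v ∈ I e, X e ω|} ≤
      Fintype.card V * (2 * Real.exp (-(2 * t ^ 2 / D))) := by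
  have h1 : {ω | ∃ v, t < |∑ e ∈ T with v ∈ I e, X e ω|} =
      ⋃ v, {ω | t < |∑ e ∈ T with v ∈ I e, X e ω|} := by
    ext ω
    simp
  rw [h1]
  refine (measureReal_iUnion_fintype_le _).trans ?_
  have := Finset.sum_le_card_nsmul Finset.univ
    (fun v => P.real {ω | t < |∑ e ∈ T with v ∈ I e, X e ω|}) _ fun v _ =>
      measureReal_abs_sum_gt_le hX h0 hp _ (hD v) ht
  simpa using this

end VertexSums

/-! ### Degrees in the layered model -/

/-- The law of the family of edge indicators of the layered `β`-model. -/
noncomputable def indicatorLaw (n r : ℕ) (B : LayerParams n r) :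
    Measure (Hyperedge n r → Bool) :=
  Measure.pi fun e : Hyperedge n r =>
    ProbabilityTheory.bernoulliMeasure true false
      ⟨edgeProb (B e.layer) e.1, edgeProb_mem_unitInterval (B e.layer) e.1⟩

instance {n r : ℕ} (B : LayerParams n r) : IsProbabilityMeasure (indicatorLaw n r B) := by
  unfold indicatorLaw
  infer_instance

/-- The centred indicator of a hyperedge. -/
noncomputable def centredIndicator {n r : ℕ} (B : LayerParams n r) (e : Hyperedge n r)
    (ω : Hyperedge n r → Bool) : ℝ :=
  (if ω e = true then 1 else 0) - edgeProb (B e.layer) e.1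

theorem iIndepFun_centredIndicator {n r : ℕ} (B : LayerParams n r) :
    ProbabilityTheory.iIndepFun (centredIndicator B) (indicatorLaw n r B) :=
  ProbabilityTheory.iIndepFun_pi
    (X := fun e b => (if b = true then (1 : ℝ) else 0) - edgeProb (B (Hyperedge.layer e)) e.1)
    fun _ => (measurable_of_finite _).aemeasurable

theorem integral_centredIndicator {n r : ℕ} (B : LayerParams n r) (e : Hyperedge n r) :
    ∫ ω, centredIndicator B e ω ∂indicatorLaw n r B = 0 := by
  have h := (measurePreserving_eval (fun e : Hyperedge n r =>
    ProbabilityTheory.bernoulliMeasure true false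
      ⟨edgeProb (B e.layer) e.1, edgeProb_mem_unitInterval (B e.layer) e.1⟩) e).map_eq
  have h2 := integral_map (μ := indicatorLaw n r B) (φ := Function.eval e)
    (f := fun b : Bool => (if b = true then (1 : ℝ) else 0) - edgeProb (B e.layer) e.1)
    (measurable_pi_apply e).aemeasurable (measurable_of_finite _).aestronglyMeasurable
  refine Eq.trans h2.symm ?_
  rw [indicatorLaw, h, ProbabilityTheory.integral_bernoulliMeasure]
  simp
  ring

theorem centredIndicator_mem_Icc {n r : ℕ} (B : LayerParams n r) (e : Hyperedge n r)
    (ω : Hyperedge n r → Bool) :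
    centredIndicator B e ω ∈
      Set.Icc (-edgeProb (B e.layer) e.1) (1 - edgeProb (B e.layer) e.1) := by
  unfold centredIndicator
  split_ifs <;> simp

theorem abs_centredIndicator_le {n r : ℕ} (B : LayerParams n r) (e : Hyperedge n r)
    (ω : Hyperedge n r → Bool) : |centredIndicator B e ω| ≤ 1 := by
  have h1 := centredIndicator_mem_Icc B e ω
  have h2 := edgeProb_mem_unitInterval (B e.layer) e.1
  exact abs_le.2 ⟨by linarith [h1.1, h2.2], by linarith [h1.2, h2.1]⟩

/-- The hyperedges in layer `s`. -/
def layerEdges (n r s : ℕ) : Finset (Hyperedge n r) := {e | e.1.card = s}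

theorem sum_layerEdges_mem {n r : ℕ} (s : Layer r) (v : Fin n) (f : Finset (Fin n) → ℝ) :
    ∑ e ∈ layerEdges n r s with v ∈ e.1, f e.1 = ∑ e ∈ uniformEdges n s with v ∈ e, f e := by
  refine Finset.sum_bij (fun e _ => e.1) ?_ ?_ ?_ ?_
  · intro e he
    simpa [layerEdges, mem_uniformEdges] using he
  · intro e _ e' _ h
    exact Subtype.ext h
  · intro e he
    simp only [Finset.mem_filter, mem_uniformEdges] at he
    exact ⟨⟨e, he.1 ▸ s.2⟩, by simpa [layerEdges] using he, rfl⟩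
  · intros
    rfl

theorem card_layerEdges_mem_le {n r : ℕ} (s : Layer r) (v : Fin n) :
    (((layerEdges n r s).filter (v ∈ ·.1)).card : ℝ) ≤ (n : ℝ) ^ (s.1 - 1) := by
  have h1 := sum_layerEdges_mem s v 1
  have h2 := (Finset.mem_Icc.1 s.2).1
  simp only [Pi.one_apply, Finset.sum_const, nsmul_eq_mul, mul_one] at h1
  rw [h1, card_uniformEdges_mem (by omega)]
  exact_mod_cast (Nat.choose_le_pow _ _).trans (Nat.pow_le_pow_left (Nat.sub_le _ _) _)

theorem sDegree_sub_expectedDegree {n r : ℕ} (B : LayerParams n r) (s : Layer r) (v : Fin n)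
    (ω : Hyperedge n r → Bool) :
    (sDegree (hypergraphOfIndicator ω) s v : ℝ) - expectedDegree s (B s) v =
      ∑ e ∈ layerEdges n r s with v ∈ e.1, centredIndicator B e ω := by
  simp_rw [centredIndicator, Finset.sum_sub_distrib]
  congr 1
  · rw [Finset.sum_boole, sDegree, hypergraphOfIndicator, layerEdges, Finset.filter_filter,
      Finset.filter_filter, Finset.filter_filter]
    congr 2
    ext e
    simp only [Finset.mem_filter]
    tauto
  · rw [expectedDegree, ← sum_layerEdges_mem s v (edgeProb (B s))]
    refine Finset.sum_congr rfl fun e he => ?_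
    simp only [layerEdges, Finset.mem_filter] at he
    have : e.layer = s := Subtype.ext he.1.2
    rw [this]

/-- The degrees in layer `s` are close to their expectations. -/
def degreeEvent {n r : ℕ} (B : LayerParams n r) (s : Layer r) : Set (LayeredHypergraph n r) :=
  {H | ∑ v, ((sDegree H s v : ℝ) - expectedDegree s (B s) v) ^ 2 ≤ 2 * (n : ℝ) ^ s.1 ∧
    ∀ v, |(sDegree H s v : ℝ) - expectedDegree s (B s) v| ≤
      Real.sqrt ((n : ℝ) ^ (s.1 - 1) * Real.log n)}

theorem measureReal_degreeEvent_compl_le {n r : ℕ} (hn : 0 < n) (B : LayerParams n r)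
    (s : Layer r) :
    (indicatorLaw n r B).real (hypergraphOfIndicator ⁻¹' (degreeEvent B s)ᶜ) ≤
      (4 * s.1 + 2) / n := by
  have hs := (Finset.mem_Icc.1 s.2).1
  have hn0 : (0 : ℝ) < n := by exact_mod_cast hn
  have : Nonempty (Fin n) := ⟨⟨0, hn⟩⟩
  have hlog : 0 ≤ Real.log n := Real.log_natCast_nonneg n
  have hpow : (n : ℝ) * (n : ℝ) ^ (s.1 - 1) = (n : ℝ) ^ s.1 := by
    rw [← pow_succ']
    congr 1
    omega
  have h1 := measureReal_sum_sq_vertexSum_le (iIndepFun_centredIndicator B)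
    (integral_centredIndicator B) (abs_centredIndicator_le B) (fun e => e.1) (layerEdges n r s)
    (D := (n : ℝ) ^ (s.1 - 1)) (k := s.1) (by positivity) (by positivity)
    (card_layerEdges_mem_le s) fun e he => by
      simp only [layerEdges, Finset.mem_filter] at he
      rw [he.2]
  have h2 := measureReal_exists_abs_vertexSum_gt_le (iIndepFun_centredIndicator B)
    (integral_centredIndicator B) (centredIndicator_mem_Icc B) (fun e => e.1) (layerEdges n r s)
    (card_layerEdges_mem_le s) (Real.sqrt_nonneg ((n : ℝ) ^ (s.1 - 1) * Real.log n))
  -- The threshold makes each vertex fail with probability at most `2 / n^2`, which leaves `2 / n`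
  -- after the union over `n` vertices.
  have h3 : Real.exp (-(2 * Real.sqrt ((n : ℝ) ^ (s.1 - 1) * Real.log n) ^ 2 /
      (n : ℝ) ^ (s.1 - 1))) = 1 / (n : ℝ) ^ 2 := by
    rw [Real.sq_sqrt (by positivity), Real.exp_neg, one_div]
    congr 1
    have h4 : 2 * ((n : ℝ) ^ (s.1 - 1) * Real.log n) / (n : ℝ) ^ (s.1 - 1) =
        Real.log ((n : ℝ) ^ 2) := by
      rw [Real.log_pow]
      field_simp
      push_cast
      ring
    rw [h4, Real.exp_log (by positivity)]
  rw [h3, Fintype.card_fin] at h2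
  rw [Fintype.card_fin, hpow] at h1
  have h5 : hypergraphOfIndicator ⁻¹' (degreeEvent B s)ᶜ ⊆
      {ω | 2 * (n : ℝ) ^ s.1 <
        ∑ v, (∑ e ∈ layerEdges n r s with v ∈ e.1, centredIndicator B e ω) ^ 2} ∪
      {ω | ∃ v, Real.sqrt ((n : ℝ) ^ (s.1 - 1) * Real.log n) <
        |∑ e ∈ layerEdges n r s with v ∈ e.1, centredIndicator B e ω|} := by
    intro ω hω
    simp only [Set.mem_preimage, Set.mem_compl_iff, degreeEvent, Set.mem_ofPred_eq,
      sDegree_sub_expectedDegree, not_and_or, not_le, not_forall] at hω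
    exact hω
  refine (measureReal_mono h5).trans ((measureReal_union_le _ _).trans ?_)
  calc _ ≤ 4 * (s.1 : ℝ) / n + n * (2 * (1 / (n : ℝ) ^ 2)) := add_le_add h1 h2
    _ = _ := by field_simp

/-! ### Assembling the layers -/

theorem solvesLikelihoodEquations_iff {n r : ℕ} (H : LayeredHypergraph n r)
    (B : LayerParams n r) :
    SolvesLikelihoodEquations H B ↔
      ∀ (s : Layer r) v, (sDegree H s v : ℝ) = expectedDegree s (B s) v := by
  refine forall_congr' fun s => forall_congr' fun v => ?_
  have hs := (Finset.mem_Icc.1 s.2).1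
  rw [sum_powersetCard_erase (by omega), expectedDegree]

/-- The constant of the rates of the maximum likelihood estimator. -/
noncomputable def rateConst (M : ℝ) (s : ℕ) : ℝ := max (l2Const s M) (linftyConst s M)

theorem rateConst_pos (M : ℝ) (s : ℕ) : 0 < rateConst M s :=
  lt_max_of_lt_left (l2Const_pos s M)

theorem eventually_iInter_degreeEvent_subset (r : ℕ) (M : ℝ) :
    ∀ᶠ n : ℕ in atTop, ∀ B : LayerParams n r, (∀ s, ‖B s‖ ≤ M) →
      ⋂ s, degreeEvent B s ⊆ mleRateEvent n r (rateConst M) B := by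
  -- There are finitely many layers, so one threshold for `n` serves all of them; only this
  -- threshold depends on `r`, not the constants.
  have h1 : ∀ᶠ n : ℕ in atTop, ∀ s : Layer r, _ := eventually_all.2 fun s : Layer r =>
    eventually_existsUnique_expectedDegree_eq (Finset.mem_Icc.1 s.2).1 M
  filter_upwards [h1] with n hn B hB H hH
  rw [Set.mem_iInter] at hH
  choose γ hγ hγ2 hγi using fun s : Layer r => hn s (fun v => sDegree H s v) (B s)
    (fun v => (norm_le_pi_norm (B s) v).trans (hB s)) (hH s).1 (hH s).2
  have h2 (B' : LayerParams n r) : SolvesLikelihoodEquations H B' ↔ B' = γ := by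
    rw [solvesLikelihoodEquations_iff, funext_iff]
    exact forall_congr' fun s => hγ s (B' s)
  refine ⟨⟨γ, (h2 γ).2 rfl, fun B' hB' => (h2 B').1 hB'⟩, fun B' hB' s => ?_⟩
  obtain rfl := (h2 B').1 hB'
  exact ⟨(hγ2 s).trans (mul_le_mul_of_nonneg_right (le_max_left _ _) (Real.sqrt_nonneg _)),
    (hγi s).trans (mul_le_mul_of_nonneg_right (le_max_right _ _) (Real.sqrt_nonneg _))⟩

theorem le_measureReal_iInter_degreeEvent {n r : ℕ} (hn : 0 < n) (B : LayerParams n r) :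
    1 - (∑ s : Layer r, (4 * (s.1 : ℝ) + 2)) / n ≤
      (layeredBetaModel n r B).real (⋂ s, degreeEvent B s) := by
  have h1 : (indicatorLaw n r B).real (hypergraphOfIndicator ⁻¹' ⋂ s, degreeEvent B s) ≤
      (layeredBetaModel n r B).real (⋂ s, degreeEvent B s) :=
    ENNReal.toReal_mono (measure_ne_top _ _)
      (Measure.le_map_apply measurable_hypergraphOfIndicator.aemeasurable _)
  refine le_trans ?_ h1
  have h2 := probReal_compl_eq_one_sub (μ := indicatorLaw n r B)
    (Set.toFinite (hypergraphOfIndicator ⁻¹' ⋂ s, degreeEvent B s)).measurableSet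
  have h3 : (indicatorLaw n r B).real (hypergraphOfIndicator ⁻¹' ⋂ s, degreeEvent B s)ᶜ ≤
      ∑ s : Layer r, (4 * (s.1 : ℝ) + 2) / n := by
    rw [← Set.preimage_compl, Set.compl_iInter, Set.preimage_iUnion]
    exact (measureReal_iUnion_fintype_le _).trans
      (Finset.sum_le_sum fun s _ => measureReal_degreeEvent_compl_le hn B s)
  rw [← Finset.sum_div] at h3
  linarith

theorem theorem2p1 (M : ℝ) (hM : 0 < M) :
    ∃ C : ℕ → ℝ, (∀ s, 0 < C s) ∧
      ∀ r : ℕ, 2 ≤ r →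
        ∀ B : (n : ℕ) → LayerParams n r, (∀ n s, ‖B n s‖ ≤ M) →
          Tendsto (fun n : ℕ => layeredBetaModel n r (B n) (mleRateEvent n r C (B n)))
            atTop (𝓝 1) := by
  refine ⟨rateConst M, rateConst_pos M, fun r _ B hB => ?_⟩
  rw [← ENNReal.tendsto_toReal_iff (fun _ => measure_ne_top _ _) ENNReal.one_ne_top,
    ENNReal.toReal_one]
  have hlim : Tendsto (fun n : ℕ => 1 - (∑ s : Layer r, (4 * (s.1 : ℝ) + 2)) / n) atTop (𝓝 1) := by
    simpa using (tendsto_const_div_atTop_nhds_zero_nat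
      (∑ s : Layer r, (4 * (s.1 : ℝ) + 2))).const_sub 1
  refine tendsto_of_tendsto_of_tendsto_of_le_of_le' hlim tendsto_const_nhds ?_
    (Eventually.of_forall fun n => measureReal_le_one)
  filter_upwards [eventually_gt_atTop 0, eventually_iInter_degreeEvent_subset r M] with n hn hsub
  exact (le_measureReal_iInter_degreeEvent hn (B n)).trans (measureReal_mono (hsub (B n) (hB n)))
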